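/- Let $m \ge 1$ and $0 \le i < m$ be integers, let $q = 2^m$ and $d = \gcd(i,m)$, and let $f : \mathbb{F}_q \to \mathbb{F}_q$ be given by $f(x) = x^{2^i+1}$. For $t \in \mathbb{F}_q$ set $$I_f(t) := \{ f(x) + t x : x \in \mathbb{F}_q \}.$$ Then: (i) if $m/d$ is even, then $|I_f(0)| = 1 + \dfrac{q-1}{2^d+1}$, and $|I_f(t)| = \dfrac{q+1}{2} + \dfrac{q-1}{2(2^d+1)}$ for every $t \in \mathbb{F}_q \setminus \{0\}$; (ii) if $m/d$ is odd, then $|I_f(0)| = q$, and $|I_f(t)| = \dfrac{q-1}{2} + \dfrac{q+1}{2(2^d+1)}$ for every $t \in \mathbb{F}_q \setminus \{0\}$. -/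

import Mathlib

/-- For a function `f` on a field `F` and `t ∈ F`, the set `I_f(t) = {f(x) + t x : x ∈ F}`. -/
def kakeyaImage {F : Type*} [Field F] (f : F → F) (t : F) : Set F :=
  {y : F | ∃ x : F, y = f x + t * x}

section FrobeniusCounting

open Finset

/-! The image size is the sum over `x` of the inverse size of the fibre through `x`. Put `D = 2 ^
gcd i m`. The substitution `y = x + 1 / v` makes the fibre size `1 + N`, where `N` counts the
solutions of an affine equation whose linear part has 1 or `D` zeros. For `t ≠ 0`, with `K` the
number of nonzero zeros of the linear part, only three pairs `(N, K)` occur, so `1 / (1 + N)` is an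
affine function of them and only the sums of `N` and `K` over `x` are needed. Setting `w = x v`
reduces these to counting `w ^ 2 ^ i + w = c` for `c = 1` and `c = 0`. The count is `D` for `c = 0`;
for `c = 1` it is `D` or 0 as `m / gcd i m` is even or odd. -/

theorem card_image_eq_sum_inv_card_fiber {α : Type*} [Fintype α] [DecidableEq α] (g : α → α) :
    (#(univ.image g) : ℚ) = ∑ x, (1 : ℚ) / #{y | g y = g x} := by
  rw [← sum_fiberwise_of_maps_to (s := univ) (t := univ.image g) (g := g)
    (fun x _ => mem_image_of_mem g (mem_univ x)), card_eq_sum_ones, Nat.cast_sum]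
  refine sum_congr rfl fun b hb => ?_
  obtain ⟨x, _, rfl⟩ := mem_image.mp hb
  rw [sum_congr rfl (g := fun _ => (1 : ℚ) / #{y | g y = g x})
    (fun y hy => by rw [(mem_filter.mp hy).2])]
  rw [sum_const, nsmul_eq_mul, Nat.cast_one, mul_one_div_cancel]
  exact_mod_cast (card_pos.mpr ⟨x, by simp⟩).ne'

variable {F : Type*} [Field F] [Fintype F] [DecidableEq F]

/-- In a finite field of order `2 ^ m`, the fixed points of `x ↦ x ^ 2 ^ i` form the subfield of
order `2 ^ gcd i m`. -/
theorem card_pow_two_pow_eq_self {m : ℕ} (hF : Fintype.card F = 2 ^ m) (i : ℕ) :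
    #{c : F | c ^ 2 ^ i = c} = 2 ^ Nat.gcd i m := by
  have h1 : #{c : F | c ^ 2 ^ i = c} = #{c : F | c ≠ 0 ∧ c ^ 2 ^ i = c} + 1 := by
    rw [← card_insert_of_notMem (a := (0 : F)) (by simp)]
    congr 1
    ext c
    by_cases hc : c = 0 <;> simp [hc]
  have h2 : #{c : F | c ≠ 0 ∧ c ^ 2 ^ i = c}
      = Nat.card (powMonoidHom (2 ^ i - 1) : Fˣ →* Fˣ).ker := by
    rw [Nat.subtype_card {u : Fˣ | u ^ (2 ^ i - 1) = 1} (fun u => by simp [MonoidHom.mem_ker])]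
    have hpow : ∀ c : F, c ^ 2 ^ i = c ^ (2 ^ i - 1) * c := fun c => by
      rw [← pow_succ, Nat.sub_add_cancel Nat.one_le_two_pow]
    symm
    refine card_bij (fun u _ => (u : F)) ?_ ?_ ?_
    · intro u hu
      simp only [mem_filter, mem_univ, true_and] at hu ⊢
      refine ⟨u.ne_zero, ?_⟩
      rw [hpow, ← Units.val_pow_eq_pow_val, hu, Units.val_one, one_mul]
    · intro u _ v _ h
      exact Units.ext h
    · intro c hc
      simp only [mem_filter, mem_univ, true_and] at hc
      refine ⟨Units.mk0 c hc.1, ?_, rfl⟩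
      have h := hc.2
      rw [hpow, mul_eq_right₀ hc.1] at h
      simpa [Units.ext_iff] using h
  -- The unit group is cyclic of order `2 ^ m - 1`, and `gcd (2 ^ i - 1) (2 ^ m - 1) = 2 ^ gcd i m -
  -- 1`.
  have h3 := IsCyclic.card_powMonoidHom_ker (G := Fˣ) (2 ^ i - 1)
  rw [Nat.card_units, Nat.card_eq_fintype_card (α := F), hF, Nat.pow_sub_one_gcd_pow_sub_one,
    Nat.gcd_comm] at h3
  rw [h1, h2, h3]
  exact Nat.sub_add_cancel Nat.one_le_two_pow

variable [CharP F 2]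

omit [DecidableEq F] in
theorem pow_two_pow_bijective (i : ℕ) : Function.Bijective fun x : F => x ^ 2 ^ i :=
  Finite.injective_iff_bijective.mp (by
    intro x y h
    exact iterateFrobenius_inj F 2 i (by simpa [iterateFrobenius_def] using h))

/-- The nonempty fibres of an additive map are translates of its kernel. -/
theorem card_fiber_eq_card_ker (L : F → F) (hL : ∀ x y, L (x + y) = L x + L y) {c v₀ : F}
    (h : L v₀ = c) : #{v | L v = c} = #{v | L v = 0} := by
  have h0 : L 0 = 0 := by simpa using hL 0 0
  have hv : L v₀ + L v₀ = 0 := CharTwo.add_self_eq_zero _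
  refine card_bij' (fun v _ => v + v₀) (fun v _ => v + v₀) ?_ ?_ ?_ ?_
  · intro v hm
    simp only [mem_filter, mem_univ, true_and] at hm ⊢
    rw [hL, hm, ← h, hv]
  · intro v hm
    simp only [mem_filter, mem_univ, true_and] at hm ⊢
    rw [hL, hm, h, zero_add]
  · intro v _
    simp [add_assoc, CharTwo.add_self_eq_zero]
  · intro v _
    simp [add_assoc, CharTwo.add_self_eq_zero]

/-- The roots of `X ^ (2 ^ i + 1) + t X = x ^ (2 ^ i + 1) + t x` other than `x` correspond, via
`y = x + 1 / v`, to the solutions of an affine equation in `v`. -/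
theorem card_fiber_eq_one_add (i : ℕ) (t x : F) :
    #{y : F | y ^ (2 ^ i + 1) + t * y = x ^ (2 ^ i + 1) + t * x}
      = 1 + #{v : F | (x ^ 2 ^ i + t) * v ^ 2 ^ i + x * v = 1} := by
  have h1 : #{y : F | y ^ (2 ^ i + 1) + t * y = x ^ (2 ^ i + 1) + t * x}
      = #{y : F | y ≠ x ∧ y ^ (2 ^ i + 1) + t * y = x ^ (2 ^ i + 1) + t * x} + 1 := by
    rw [← card_insert_of_notMem (a := x) (by simp)]
    congr 1
    ext c
    by_cases hc : c = x <;> simp [hc]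
  have key : ∀ u : F, u ≠ 0 →
      ((x + u) ^ (2 ^ i + 1) + t * (x + u) = x ^ (2 ^ i + 1) + t * x ↔
        (x ^ 2 ^ i + t) * u⁻¹ ^ 2 ^ i + x * u⁻¹ = 1) := by
    intro u hu
    have hu' : u ^ 2 ^ i ≠ 0 := pow_ne_zero _ hu
    have e1 : (x + u) ^ (2 ^ i + 1) + t * (x + u) - (x ^ (2 ^ i + 1) + t * x)
        = u ^ 2 ^ i * u * ((x ^ 2 ^ i + t) * u⁻¹ ^ 2 ^ i + x * u⁻¹ + 1) := by
      rw [pow_succ, add_pow_char_pow, inv_pow]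
      field_simp
      ring
    rw [← sub_eq_zero, e1, mul_eq_zero_iff_left (mul_ne_zero hu' hu), CharTwo.add_eq_zero]
  rw [h1, add_comm]
  congr 1
  have hne : ∀ v : F, (x ^ 2 ^ i + t) * v ^ 2 ^ i + x * v = 1 → v ≠ 0 := by
    rintro v h rfl
    simp at h
  refine card_bij' (fun y _ => (x + y)⁻¹) (fun v _ => x + v⁻¹) ?_ ?_ ?_ ?_
  · intro y hy
    simp only [mem_filter, mem_univ, true_and] at hy ⊢
    refine (key (x + y) fun h => hy.1 (CharTwo.add_eq_zero.mp h).symm).mp ?_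
    rw [← add_assoc, CharTwo.add_self_eq_zero, zero_add]
    exact hy.2
  · intro v hv
    simp only [mem_filter, mem_univ, true_and] at hv ⊢
    have h0 := hne v hv
    refine ⟨by simpa using h0, (key v⁻¹ (inv_ne_zero h0)).mpr (by simpa using hv)⟩
  · intro y _
    simp [← add_assoc, CharTwo.add_self_eq_zero]
  · intro v _
    simp [← add_assoc, CharTwo.add_self_eq_zero]

/-- Double counting via `w = x v`. -/
theorem sum_card_nonzero_solutions (i : ℕ) {t : F} (ht : t ≠ 0) (c : F) :
    ∑ x : F, #{v : F | v ≠ 0 ∧ (x ^ 2 ^ i + t) * v ^ 2 ^ i + x * v = c}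
      = #{w : F | w ^ 2 ^ i + w ≠ c} := by
  rw [← card_sigma]
  have hid : ∀ x v : F, (x ^ 2 ^ i + t) * v ^ 2 ^ i + x * v
      = ((x * v) ^ 2 ^ i + x * v) + t * v ^ 2 ^ i := fun x v => by rw [mul_pow]; ring
  refine card_bij (fun p _ => p.1 * p.2) ?_ ?_ ?_
  · rintro ⟨x, v⟩ h
    simp only [mem_sigma, mem_filter, mem_univ, true_and, hid] at h ⊢
    intro h'
    rw [h', add_eq_left] at h
    exact mul_ne_zero ht (pow_ne_zero _ h.1) h.2
  · rintro ⟨x, v⟩ h ⟨x', v'⟩ h' hw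
    simp only [mem_sigma, mem_filter, mem_univ, true_and, hid] at h h' hw
    have h2 := h.2.trans h'.2.symm
    rw [hw, add_right_inj, mul_right_inj' ht] at h2
    have hv : v = v' := (pow_two_pow_bijective i).1 h2
    subst hv
    rw [mul_left_inj' h.1] at hw
    rw [hw]
  · intro w hw
    simp only [mem_filter, mem_univ, true_and] at hw
    -- Once `w = x v` is fixed, the equation reads `t * v ^ 2 ^ i = c - (w ^ 2 ^ i + w)` and
    -- determines `v`.
    obtain ⟨v, hv⟩ := (pow_two_pow_bijective (F := F) i).2 ((c - (w ^ 2 ^ i + w)) / t)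
    simp only at hv
    have h0 : v ≠ 0 := by
      rintro rfl
      rw [zero_pow (by positivity), eq_comm, div_eq_zero_iff, sub_eq_zero] at hv
      exact hv.elim (fun h => hw h.symm) ht
    refine ⟨⟨w / v, v⟩, ?_, div_mul_cancel₀ w h0⟩
    simp only [mem_sigma, mem_filter, mem_univ, true_and, hid]
    refine ⟨h0, ?_⟩
    rw [div_mul_cancel₀ w h0, hv]
    field_simp
    ring

omit [Fintype F] [DecidableEq F] in
-- Frobenius powers fix 1, so each iteration adds another 1; in characteristic 2 only the parity of
-- `k` matters.
theorem pow_two_pow_mul_of_eq_add_one {d : ℕ} {z : F} (hz : z ^ 2 ^ d = z + 1) (k : ℕ) :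
    z ^ 2 ^ (d * k) = z + k := by
  induction k with
  | zero => simp
  | succ k ih =>
    rw [Nat.mul_succ, add_comm, pow_add, pow_mul, hz, add_pow_char_pow, ih, one_pow,
      Nat.cast_succ, add_assoc]

/-- The equation `w ^ 2 ^ i + w = 1` is solvable when `m / gcd i m` is even. -/
theorem exists_pow_two_pow_add_eq_one {m i : ℕ} (hF : Fintype.card F = 2 ^ m) (hm : 0 < m)
    (h : Even (m / Nat.gcd i m)) : ∃ w : F, w ^ 2 ^ i + w = 1 := by
  set d := Nat.gcd i m with hd
  have hd0 : 0 < d := Nat.gcd_pos_of_pos_right _ hm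
  have hcop : Nat.Coprime (i / d) (m / d) := Nat.coprime_div_gcd_div_gcd hd0
  have hid : d * (i / d) = i := Nat.mul_div_cancel' (Nat.gcd_dvd_left _ _)
  have hmd : d * (m / d) = m := Nat.mul_div_cancel' (Nat.gcd_dvd_right _ _)
  have hodd : Odd (i / d) := by
    by_contra hc
    have := Nat.dvd_gcd (Nat.not_odd_iff_even.mp hc).two_dvd h.two_dvd
    rw [hcop] at this
    omega
  have hS : #{c : F | c ^ 2 ^ (d * 2) = c} = 2 ^ (d * 2) := by
    rw [card_pow_two_pow_eq_self hF, Nat.gcd_eq_left]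
    rw [← hmd]
    exact Nat.mul_dvd_mul_left _ h.two_dvd
  have hT : #{c : F | c ^ 2 ^ d = c} = 2 ^ d := by
    rw [card_pow_two_pow_eq_self hF, Nat.gcd_eq_left (Nat.gcd_dvd_right _ _)]
  -- Take `a` in the subfield of order `2 ^ (2 * d)` but outside that of order `2 ^ d`. Dividing it
  -- by its relative trace `u` gives trace 1.
  obtain ⟨a, ha, ha'⟩ : ∃ a : F, a ^ 2 ^ (d * 2) = a ∧ a ^ 2 ^ d ≠ a := by
    by_contra! hc
    have hle : #{c : F | c ^ 2 ^ (d * 2) = c} ≤ #{c : F | c ^ 2 ^ d = c} :=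
      card_le_card fun x hx => by
        simp only [mem_filter, mem_univ, true_and] at hx ⊢
        exact hc x hx
    rw [hS, hT] at hle
    have := (Nat.pow_le_pow_iff_right (by norm_num)).mp hle
    omega
  set u := a ^ 2 ^ d + a with hu
  have hu0 : u ≠ 0 := fun h0 => ha' (CharTwo.add_eq_zero.mp h0)
  have hud : u ^ 2 ^ d = u := by
    rw [hu, add_pow_char_pow, ← pow_mul, ← pow_add, ← mul_two, ha, add_comm]
  have hw : (a / u) ^ 2 ^ d = a / u + 1 := by
    rw [div_pow, hud, div_add_one hu0, hu, add_comm (a ^ 2 ^ d) a, ← add_assoc,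
      CharTwo.add_self_eq_zero, zero_add]
  refine ⟨a / u, ?_⟩
  rw [← hid, pow_two_pow_mul_of_eq_add_one hw, CharTwo.natCast_eq_ite (i / d), if_neg (Nat.not_even_iff_odd.mpr hodd)]
  rw [add_right_comm, CharTwo.add_self_eq_zero, zero_add]

omit [DecidableEq F] in
/-- The equation `w ^ 2 ^ i + w = 1` has no solution when `m / gcd i m` is odd. -/
theorem pow_two_pow_add_ne_one {m i : ℕ} (hF : Fintype.card F = 2 ^ m)
    (h : Odd (m / Nat.gcd i m)) (w : F) : w ^ 2 ^ i + w ≠ 1 := by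
  intro hw
  set d := Nat.gcd i m with hd
  have hw' : w ^ 2 ^ i = w + 1 := by rw [← hw, add_left_comm, CharTwo.add_self_eq_zero, add_zero]
  have h1 := pow_two_pow_mul_of_eq_add_one hw' (m / d)
  -- Iterating `m / d` times gives a power of `x ↦ x ^ 2 ^ m`, the identity, yet it adds 1 an odd
  -- number of times.
  have hexp : i * (m / d) = m * (i / d) := by
    rw [← Nat.mul_div_assoc _ (Nat.gcd_dvd_right i m), ← Nat.mul_div_assoc _ (Nat.gcd_dvd_left i m),
      mul_comm]
  rw [hexp, pow_mul, ← hF, FiniteField.pow_card_pow,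
    CharTwo.natCast_eq_ite (m / d), if_neg (Nat.not_even_iff_odd.mpr h)] at h1
  simp at h1

theorem card_pow_two_pow_add_eq_zero {m : ℕ} (hF : Fintype.card F = 2 ^ m) (i : ℕ) :
    #{w : F | w ^ 2 ^ i + w = 0} = 2 ^ Nat.gcd i m := by
  simp_rw [CharTwo.add_eq_zero]
  exact card_pow_two_pow_eq_self hF i

/-- The possible numbers of solutions of the affine equation and of its linear part. -/
theorem card_solutions_trichotomy {m : ℕ} (hF : Fintype.card F = 2 ^ m) (i : ℕ) {t : F}
    (ht : t ≠ 0) (x : F) :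
    (#{v : F | v ≠ 0 ∧ (x ^ 2 ^ i + t) * v ^ 2 ^ i + x * v = 0} = 0 ∧
      #{v : F | (x ^ 2 ^ i + t) * v ^ 2 ^ i + x * v = 1} = 1) ∨
    (#{v : F | v ≠ 0 ∧ (x ^ 2 ^ i + t) * v ^ 2 ^ i + x * v = 0} + 1 = 2 ^ Nat.gcd i m ∧
      (#{v : F | (x ^ 2 ^ i + t) * v ^ 2 ^ i + x * v = 1} = 0 ∨
        #{v : F | (x ^ 2 ^ i + t) * v ^ 2 ^ i + x * v = 1} = 2 ^ Nat.gcd i m)) := by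
  set A := x ^ 2 ^ i + t with hA
  let L : F → F := fun v => A * v ^ 2 ^ i + x * v
  have hL : ∀ v w, L (v + w) = L v + L w := fun v w => by
    simp only [L]
    rw [add_pow_char_pow]
    ring
  have h1 : #{v : F | L v = 0} = #{v : F | v ≠ 0 ∧ L v = 0} + 1 := by
    rw [← card_insert_of_notMem (a := (0 : F)) (by simp)]
    congr 1
    ext c
    by_cases hc : c = 0 <;> simp [hc, L]
  change (#{v : F | v ≠ 0 ∧ L v = 0} = 0 ∧ #{v : F | L v = 1} = 1) ∨
    (#{v : F | v ≠ 0 ∧ L v = 0} + 1 = _ ∧ (#{v : F | L v = 1} = 0 ∨ #{v : F | L v = 1} = _))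
  by_cases hex : ∃ v, v ≠ 0 ∧ L v = 0
  · obtain ⟨v₀, hv₀, hLv₀⟩ := hex
    right
    have hA0 : A ≠ 0 := by
      intro h0
      simp only [L, h0, zero_mul, zero_add, mul_eq_zero, hv₀, or_false] at hLv₀
      rw [hA, hLv₀, zero_pow (by positivity), zero_add] at h0
      exact ht h0
    have hker : #{v : F | L v = 0} = 2 ^ Nat.gcd i m := by
      rw [← card_pow_two_pow_eq_self hF i]
      -- This shows that the kernel is the line through `v₀` over the fixed field of `c ↦ c ^ 2 ^
      -- i`.
      have hLm : ∀ c, L (c * v₀) = A * v₀ ^ 2 ^ i * (c ^ 2 ^ i - c) := fun c => by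
        have : L (c * v₀) = A * v₀ ^ 2 ^ i * (c ^ 2 ^ i - c) + c * L v₀ := by
          simp only [L, mul_pow]
          ring
        rw [this, hLv₀, mul_zero, add_zero]
      refine (card_bij (fun c _ => c * v₀) ?_ ?_ ?_).symm
      · intro c hc
        simp only [mem_filter, mem_univ, true_and] at hc ⊢
        rw [hLm, hc, sub_self, mul_zero]
      · intro a _ b _ hab
        exact mul_right_cancel₀ hv₀ hab
      · intro v hv
        simp only [mem_filter, mem_univ, true_and] at hv
        refine ⟨v / v₀, ?_, div_mul_cancel₀ v hv₀⟩
        rw [← div_mul_cancel₀ v hv₀, hLm,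
          mul_eq_zero_iff_left (mul_ne_zero hA0 (pow_ne_zero _ hv₀)), sub_eq_zero] at hv
        simpa using hv
    refine ⟨by rw [← h1, hker], ?_⟩
    by_cases h : ∃ v, L v = 1
    · obtain ⟨v, hv⟩ := h
      right
      rw [card_fiber_eq_card_ker L hL hv, hker]
    · push Not at h
      left
      simp [h]
  · left
    have hk0 : #{v : F | v ≠ 0 ∧ L v = 0} = 0 := by
      rw [card_eq_zero, filter_eq_empty_iff]
      intro v _ hv
      exact hex ⟨v, hv⟩
    refine ⟨hk0, ?_⟩
    have hinj : Function.Injective L := by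
      intro v w hvw
      by_contra hne
      exact hex ⟨v + w, fun h => hne (CharTwo.add_eq_zero.mp h), by
        rw [hL, hvw, CharTwo.add_self_eq_zero]⟩
    obtain ⟨v, hv⟩ := (Finite.injective_iff_surjective.mp hinj) 1
    rw [card_fiber_eq_card_ker L hL hv, h1, hk0]

/-- The image size for `t ≠ 0`, in terms of the number of solutions of `w ^ 2 ^ i + w = 1`. -/
theorem card_image_of_ne_zero {m i : ℕ} (hF : Fintype.card F = 2 ^ m) (hm : 0 < m) {t : F}
    (ht : t ≠ 0) :
    (#(univ.image fun x : F => x ^ (2 ^ i + 1) + t * x) : ℚ)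
      = 2 ^ m / 2 + (2 ^ m - 2 ^ Nat.gcd i m) / (2 * (2 ^ Nat.gcd i m + 1))
        + #{w : F | w ^ 2 ^ i + w = 1} / (2 ^ Nat.gcd i m + 1) := by
  have hd0 : 0 < Nat.gcd i m := Nat.gcd_pos_of_pos_right _ hm
  set D : ℚ := 2 ^ Nat.gcd i m with hD
  have hD1 : (0 : ℚ) < D := by positivity
  have compl : ∀ c : F, (#{w : F | w ^ 2 ^ i + w ≠ c} : ℚ)
      = 2 ^ m - #{w : F | w ^ 2 ^ i + w = c} := fun c => by
    have := card_filter_add_card_filter_not (s := (univ : Finset F))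
      (fun w : F => w ^ 2 ^ i + w = c)
    rw [card_univ, hF] at this
    rw [eq_sub_iff_add_eq, add_comm]
    exact_mod_cast this
  have s0 : ∑ x : F, (#{v : F | v ≠ 0 ∧ (x ^ 2 ^ i + t) * v ^ 2 ^ i + x * v = 0} : ℚ)
      = 2 ^ m - D := by
    rw [← Nat.cast_sum, sum_card_nonzero_solutions i ht, compl,
      card_pow_two_pow_add_eq_zero hF, Nat.cast_pow, Nat.cast_ofNat]
  have s1 : ∑ x : F, (#{v : F | (x ^ 2 ^ i + t) * v ^ 2 ^ i + x * v = 1} : ℚ)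
      = 2 ^ m - #{w : F | w ^ 2 ^ i + w = 1} := by
    rw [← compl, ← sum_card_nonzero_solutions i ht, Nat.cast_sum]
    refine sum_congr rfl fun x _ => ?_
    congr 2
    ext v
    simp only [mem_filter, mem_univ, true_and, iff_and_self]
    rintro h rfl
    simp at h
  rw [card_image_eq_sum_inv_card_fiber]
  -- Affine interpolation of `1 / (1 + N)` through `(N, K) = (1, 0), (0, D - 1), (D, D - 1)`.
  have hterm : ∀ x : F,
      (1 : ℚ) / #{y : F | y ^ (2 ^ i + 1) + t * y = x ^ (2 ^ i + 1) + t * x}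
        = (1 / 2 + 1 / (D + 1))
          - #{v : F | (x ^ 2 ^ i + t) * v ^ 2 ^ i + x * v = 1} / (D + 1)
          + #{v : F | v ≠ 0 ∧ (x ^ 2 ^ i + t) * v ^ 2 ^ i + x * v = 0} / (2 * (D + 1)) := by
    intro x
    rw [card_fiber_eq_one_add]
    have hcast : ∀ n : ℕ, n + 1 = 2 ^ Nat.gcd i m → (n : ℚ) = D - 1 := fun n hn => by
      rw [hD, eq_sub_iff_add_eq]
      exact_mod_cast hn
    rcases card_solutions_trichotomy hF i ht x with ⟨h0, h1⟩ | ⟨h0, h1 | h1⟩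
    · rw [h0, h1]
      push_cast
      field_simp
      ring
    · rw [hcast _ h0, h1]
      push_cast
      field_simp
      ring
    · rw [hcast _ h0, h1]
      push_cast
      rw [← hD]
      field_simp
      ring
  rw [sum_congr rfl fun x _ => hterm x, sum_add_distrib, sum_sub_distrib, ← sum_div, ← sum_div,
    s0, s1, sum_const, card_univ, hF, nsmul_eq_mul]
  push_cast
  field_simp
  ring

/-- The image size for `t = 0`, in terms of the number of solutions of `w ^ 2 ^ i + w = 1`. -/
theorem card_image_zero {m i : ℕ} (hF : Fintype.card F = 2 ^ m) :
    (#(univ.image fun x : F => x ^ (2 ^ i + 1) + 0 * x) : ℚ)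
      = 1 + (2 ^ m - 1) / (1 + #{w : F | w ^ 2 ^ i + w = 1}) := by
  rw [card_image_eq_sum_inv_card_fiber, ← add_sum_erase univ _ (mem_univ (0 : F))]
  have h0 : #{y : F | y ^ (2 ^ i + 1) + 0 * y = 0 ^ (2 ^ i + 1) + 0 * 0} = 1 := by
    rw [card_fiber_eq_one_add]
    simp
  have h1 : ∀ x ∈ univ.erase (0 : F),
      (1 : ℚ) / #{y : F | y ^ (2 ^ i + 1) + 0 * y = x ^ (2 ^ i + 1) + 0 * x}
        = 1 / (1 + #{w : F | w ^ 2 ^ i + w = 1}) := by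
    intro x hx
    have hx0 : x ≠ 0 := (mem_erase.mp hx).1
    rw [card_fiber_eq_one_add, Nat.cast_add, Nat.cast_one]
    congr 3
    -- With `t = 0`, scaling by `x` makes the equation independent of `x`.
    refine card_bij' (fun v _ => x * v) (fun w _ => w / x) ?_ ?_ ?_ ?_
    · intro v hv
      simpa [mul_pow] using hv
    · intro w hw
      simp only [mem_filter, mem_univ, true_and, add_zero] at hw ⊢
      rw [← mul_pow, mul_div_cancel₀ w hx0, hw]
    · intro v _
      exact mul_div_cancel_left₀ v hx0
    · intro w _
      exact mul_div_cancel₀ w hx0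
  rw [h0, sum_congr rfl h1, sum_const, card_erase_of_mem (mem_univ _), card_univ, hF, nsmul_eq_mul,
    Nat.cast_sub Nat.one_le_two_pow]
  push_cast
  ring

end FrobeniusCounting

theorem mainTheorem5 {F : Type*} [Field F] [Finite F] (q m i d : ℕ)
    (hq : q = 2 ^ m) (hF : Nat.card F = q) (him : i < m) (hd : d = Nat.gcd i m)
    (f : F → F) (hf : ∀ x : F, f x = x ^ (2 ^ i + 1)) :
    (Even (m / d) →
      ((kakeyaImage f 0).ncard : ℚ) = 1 + ((q : ℚ) - 1) / (2 ^ d + 1) ∧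
      ∀ t : F, t ≠ 0 →
        ((kakeyaImage f t).ncard : ℚ)
          = ((q : ℚ) + 1) / 2 + ((q : ℚ) - 1) / (2 * (2 ^ d + 1))) ∧
    (Odd (m / d) →
      (kakeyaImage f 0).ncard = q ∧
      ∀ t : F, t ≠ 0 →
        ((kakeyaImage f t).ncard : ℚ)
          = ((q : ℚ) - 1) / 2 + ((q : ℚ) + 1) / (2 * (2 ^ d + 1))) := by
  classical
  have := Fintype.ofFinite F
  subst hq hd
  rw [Nat.card_eq_fintype_card] at hF
  have hm : 0 < m := by omega
  have : CharP F 2 := charP_of_card_eq_prime_pow hF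
  have himg : ∀ t : F, (kakeyaImage f t).ncard
      = (Finset.univ.image fun x : F => x ^ (2 ^ i + 1) + t * x).card := fun t => by
    rw [← Set.ncard_coe_finset]
    congr 1
    ext y
    simp [kakeyaImage, hf, eq_comm]
  have hD : (0 : ℚ) < 2 ^ Nat.gcd i m := by positivity
  refine ⟨fun h => ?_, fun h => ?_⟩
  · obtain ⟨w, hw⟩ := exists_pow_two_pow_add_eq_one hF hm h
    have he : (Finset.univ.filter fun w : F => w ^ 2 ^ i + w = 1).card = 2 ^ Nat.gcd i m := by
      rw [card_fiber_eq_card_ker (fun w : F => w ^ 2 ^ i + w)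
        (fun x y => by rw [add_pow_char_pow]; ring) hw, card_pow_two_pow_add_eq_zero hF]
    refine ⟨?_, fun t ht => ?_⟩
    · rw [himg, card_image_zero hF, he]
      push_cast
      ring
    · rw [himg, card_image_of_ne_zero hF hm ht, he]
      push_cast
      field_simp
      ring
  · have he : (Finset.univ.filter fun w : F => w ^ 2 ^ i + w = 1).card = 0 := by
      simp [pow_two_pow_add_ne_one hF h]
    refine ⟨?_, fun t ht => ?_⟩
    · rw [← Nat.cast_inj (R := ℚ), himg, card_image_zero hF, he]
      push_cast
      ring
    · rw [himg, card_image_of_ne_zero hF hm ht, he]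
      push_cast
      field_simp
      ring
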